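/- Let $X$ be a compact Hausdorff space and let $A$ be a uniform algebra on $X$, that is, a subalgebra of the algebra $C(X)$ of complex-valued continuous functions on $X$ that contains the constant functions, is closed in the supremum norm, and separates the points of $X$. Regard $A$ as a complex Banach space with the supremum norm. Then $A$ has the complex Mazur–Ulam property: for every complex Banach space $B$ and every surjective isometry $T$ from the unit sphere $\{a\in A:\|a\|=1\}$ onto the unit sphere $\{b\in B:\|b\|=1\}$ (with respect to the metrics induced by the norms), there is a surjective real-linear isometry $L:A\to B$ with $L(a)=T(a)$ for every $a\in A$ with $\|a\|=1$. -/

import Mathlib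

/-- A uniform algebra on a compact Hausdorff space `X`: a subalgebra of `C(X, ℂ)` (so it contains
the constant functions) that is closed in the supremum norm and separates the points of `X`. -/
structure IsUniformAlgebra {X : Type*} [TopologicalSpace X] [CompactSpace X] [T2Space X]
    (A : Subalgebra ℂ C(X, ℂ)) : Prop where
  isClosed : IsClosed (A : Set C(X, ℂ))
  separatesPoints : A.SeparatesPoints

universe u v

/-- The complex Mazur–Ulam property of a complex Banach space `E`: every surjective isometry from
the unit sphere of `E` onto the unit sphere of any complex Banach space `F` extends to a surjective
real-linear isometry from `E` onto `F`. The real structures are the restrictions of scalars of the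
complex ones. -/
def HasComplexMazurUlamProperty (E : Type u) [NormedAddCommGroup E] [NormedSpace ℂ E] : Prop :=
  ∀ (F : Type v) [NormedAddCommGroup F] [NormedSpace ℂ F] [CompleteSpace F]
    (T : Metric.sphere (0 : E) 1 → Metric.sphere (0 : F) 1),
    Isometry T → Function.Surjective T →
      ∃ L : E ≃ₗᵢ[ℝ] F, ∀ a : Metric.sphere (0 : E) 1, L (a : E) = (T a : F)

/-!
The proof compares the faces, that is the maximal convex subsets, of the two unit spheres.

*Faces are metric objects.* A face `C` is self-polar for the relation `‖y + c‖ = 2` and is directed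
by it. A surjective isometry `T` of spheres turns `‖y + c‖ = 2` into `‖T y - T (-c)‖ = 2`, so that
`T(C)` and `-T(-C)` are polar to each other; directedness makes them equal and `T(C)` a face
(`IsSphereIsometry.image_face`). By Hahn–Banach each face of the target is a slice `{b | q b = 1}`
of the unit sphere with `q` a functional of norm at most `1`.

*Faces of a uniform algebra.* By compactness each face of `A` is the set of norm-one functions with
a fixed unimodular value `l` at some point `x`, and such an `x` can be isolated by peaking functions
(`IsSphereFace.isPeakingPoint`). The analytic tool is Bishop's construction
(`exists_peaking_dominating`): a function of `A` peaking on a set may decay away from it faster than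
any prescribed continuous function.

*Matching functionals with points.* Let `q` define the image of the face of functions with value `1`
at `x`. The rotated faces `{b | q b = γ}` of the target come from faces of `A`, and since faces at
different points of `X` are far apart while nearby rotations are close, they all come from the
point `x`. The correspondence of values is an isometry of the unit circle, hence the restriction
of an isometry `e` that is the identity or the conjugation. So `q (T a) = e (a x)` whenever
`|a x| = 1`. For other values, `a` is at distance at most `1 - |a x|` from the face at `x` given by
the phase of `a x`, and at distance at most `|a x|` from the norm-one functions vanishing at `x`;
together these pin down `q (T a) = e (a x)` (`IsSphereIsometry.exists_functional_eq_apply`).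

*Conclusion.* Every norm-one function lies in a face, so the functionals `q` separate the points of
the target. In terms of them the positively homogeneous extension of `T` is real-linear.
-/

/-! ### Maximal convex subsets of the unit sphere -/

section Faces

variable {E F : Type*} [NormedAddCommGroup E] [NormedSpace ℝ E]
  [NormedAddCommGroup F] [NormedSpace ℝ F]

/-- A face of the unit sphere: a maximal element among the nonempty convex subsets of the
unit sphere. -/
def IsSphereFace (C : Set E) : Prop :=
  Maximal (fun D : Set E => D.Nonempty ∧ Convex ℝ D ∧ D ⊆ Metric.sphere 0 1) C

/-- A surjective isometry between unit spheres, encoded as a map of the ambient spaces whose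
values off the unit sphere are irrelevant. -/
structure IsSphereIsometry {E F : Type*} [NormedAddCommGroup E] [NormedAddCommGroup F]
    (T : E → F) : Prop where
  norm_map : ∀ a, ‖a‖ = 1 → ‖T a‖ = 1
  norm_sub : ∀ a b, ‖a‖ = 1 → ‖b‖ = 1 → ‖T a - T b‖ = ‖a - b‖
  surj : ∀ b, ‖b‖ = 1 → ∃ a, ‖a‖ = 1 ∧ T a = b

namespace IsSphereFace

lemma norm_eq {C : Set E} (hC : IsSphereFace C) {c : E} (hc : c ∈ C) : ‖c‖ = 1 := by
  simpa using hC.prop.2.2 hc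

lemma nonempty {C : Set E} (hC : IsSphereFace C) : C.Nonempty := hC.prop.1

lemma convex {C : Set E} (hC : IsSphereFace C) : Convex ℝ C := hC.prop.2.1

end IsSphereFace

lemma exists_common_support {x y : E} (hx : ‖x‖ = 1) (hy : ‖y‖ = 1) (h : ‖x + y‖ = 2) :
    ∃ f : E →L[ℝ] ℝ, (∀ z, f z ≤ ‖z‖) ∧ f x = 1 ∧ f y = 1 := by
  obtain ⟨f, hf, hfx⟩ := exists_dual_vector'' ℝ (x + y)
  have hle : ∀ z, f z ≤ ‖z‖ := fun z =>
    (le_abs_self _).trans ((f.le_opNorm z).trans (by nlinarith [norm_nonneg z]))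
  have h1 := hle x
  have h2 := hle y
  have h3 : f x + f y = 2 := by rw [← map_add, hfx, h]; norm_num
  exact ⟨f, hle, by linarith, by linarith⟩

lemma norm_add_eq_two {x y : E} (hx : ‖x‖ = 1) (hy : ‖y‖ = 1) {f : E →L[ℝ] ℝ}
    (hf : ∀ z, f z ≤ ‖z‖) (h1 : f x = 1) (h2 : f y = 1) : ‖x + y‖ = 2 := by
  have := hf (x + y)
  rw [map_add, h1, h2] at this
  linarith [norm_add_le x y]

lemma norm_combo_eq_one {x y : E} (hx : ‖x‖ = 1) (hy : ‖y‖ = 1) {f : E →L[ℝ] ℝ}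
    (hf : ∀ z, f z ≤ ‖z‖) (h1 : f x = 1) (h2 : f y = 1) {s t : ℝ} (hs : 0 ≤ s) (ht : 0 ≤ t)
    (hst : s + t = 1) : ‖s • x + t • y‖ = 1 ∧ f (s • x + t • y) = 1 := by
  have hv : f (s • x + t • y) = 1 := by simp [h1, h2, hst]
  refine ⟨le_antisymm ?_ (by simpa [hv] using hf (s • x + t • y)), hv⟩
  refine (norm_add_le _ _).trans ?_
  rw [norm_smul, norm_smul, Real.norm_of_nonneg hs, Real.norm_of_nonneg ht, hx, hy]
  linarith

lemma exists_sphereFace_mem {a : E} (ha : ‖a‖ = 1) : ∃ C : Set E, IsSphereFace C ∧ a ∈ C := by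
  obtain ⟨C, haC, hC⟩ := zorn_subset_nonempty
    {D : Set E | D.Nonempty ∧ Convex ℝ D ∧ D ⊆ Metric.sphere 0 1} (by
      intro c hc hchain hne
      refine ⟨⋃₀ c, ⟨?_, ?_, ?_⟩, fun s hs => Set.subset_sUnion_of_mem hs⟩
      · obtain ⟨D, hD⟩ := hne
        obtain ⟨d, hd⟩ := (hc hD).1
        exact ⟨d, D, hD, hd⟩
      · exact hchain.directedOn.convex_sUnion fun D hD => (hc hD).2.1
      · exact Set.sUnion_subset fun D hD => (hc hD).2.2) {a}
    ⟨Set.singleton_nonempty a, convex_singleton a, by simpa using ha⟩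
  exact ⟨C, hC, haC rfl⟩

/-- A face is its own polar for the relation `‖y + c‖ = 2`. -/
lemma IsSphereFace.mem_iff {C : Set E} (hC : IsSphereFace C) {y : E} :
    y ∈ C ↔ ‖y‖ = 1 ∧ ∀ c ∈ C, ‖y + c‖ = 2 := by
  constructor
  · intro hy
    refine ⟨hC.norm_eq hy, fun c hc => ?_⟩
    have h := hC.norm_eq (hC.convex hy hc (by norm_num : (0 : ℝ) ≤ 1 / 2)
      (by norm_num : (0 : ℝ) ≤ 1 / 2) (by norm_num))
    rw [← smul_add, norm_smul, Real.norm_of_nonneg (by norm_num)] at h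
    linarith
  · rintro ⟨hy, h⟩
    have hsub : convexJoin ℝ {y} C ⊆ Metric.sphere 0 1 := by
      intro z hz
      obtain ⟨y', rfl, c, hc, s, t, hs, ht, hst, rfl⟩ := mem_convexJoin.1 hz
      obtain ⟨f, hf, h1, h2⟩ := exists_common_support hy (hC.norm_eq hc) (h c hc)
      simpa using (norm_combo_eq_one hy (hC.norm_eq hc) hf h1 h2 hs ht hst).1
    obtain ⟨c, hc⟩ := hC.nonempty
    have hyJ : y ∈ convexJoin ℝ {y} C :=
      mem_convexJoin.2 ⟨y, rfl, c, hc, left_mem_segment ℝ y c⟩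
    exact hC.le_of_ge ⟨⟨y, hyJ⟩, (convex_singleton y).convexJoin hC.convex, hsub⟩
      (fun d hd => mem_convexJoin.2 ⟨y, rfl, d, hd, right_mem_segment ℝ y d⟩) hyJ

/-- Directedness of a face: the midpoint of two points of the face is opposite to fewer points
of the sphere than either of them. -/
lemma IsSphereFace.directed {C : Set E} (hC : IsSphereFace C) {c d : E} (hc : c ∈ C)
    (hd : d ∈ C) : ∃ m ∈ C, ∀ y, ‖y‖ = 1 → ‖y + m‖ = 2 → ‖y + c‖ = 2 ∧ ‖y + d‖ = 2 := by
  have hm := hC.convex hc hd (by norm_num : (0 : ℝ) ≤ 1 / 2)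
    (by norm_num : (0 : ℝ) ≤ 1 / 2) (by norm_num)
  refine ⟨_, hm, fun y hy h => ?_⟩
  obtain ⟨f, hf, h1, h2⟩ := exists_common_support hy (hC.norm_eq hm) h
  have hfc := hf c
  have hfd := hf d
  rw [hC.norm_eq hc] at hfc
  rw [hC.norm_eq hd] at hfd
  simp only [map_add, map_smul, smul_eq_mul] at h2
  exact ⟨norm_add_eq_two hy (hC.norm_eq hc) hf h1 (by linarith),
    norm_add_eq_two hy (hC.norm_eq hd) hf h1 (by linarith)⟩

/-- Self-polarity and directedness characterise faces; both conditions only involve distances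
between points of the sphere and antipodes of points of the sphere. -/
lemma isSphereFace_of_polar {G : Set E} (hne : G.Nonempty)
    (hpol : ∀ y, y ∈ G ↔ ‖y‖ = 1 ∧ ∀ g ∈ G, ‖y + g‖ = 2)
    (hdir : ∀ c ∈ G, ∀ d ∈ G, ∃ m ∈ G, ∀ y, ‖y‖ = 1 → ‖y + m‖ = 2 →
      ‖y + c‖ = 2 ∧ ‖y + d‖ = 2) : IsSphereFace G := by
  have hn : ∀ g ∈ G, ‖g‖ = 1 := fun g hg => ((hpol g).1 hg).1
  have hhalf : (0 : ℝ) ≤ 1 / 2 := by norm_num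
  have hhs : (1 / 2 : ℝ) + 1 / 2 = 1 := by norm_num
  have key : ∀ c ∈ G, ∀ d ∈ G, ∀ e ∈ G,
      ∃ f : E →L[ℝ] ℝ, (∀ z, f z ≤ ‖z‖) ∧ f c = 1 ∧ f d = 1 ∧ f e = 1 := by
    intro c hc d hd e he
    obtain ⟨m, hm, hmcd⟩ := hdir c hc d hd
    obtain ⟨n, hnG, hne⟩ := hdir m hm e he
    have hn1 := hn n hnG
    -- `n` dominates `c`, `d` and `e`; support functionals of midpoints with `n` accumulate
    -- the three values one after the other.
    have dom : ∀ y, ‖y‖ = 1 → ‖y + n‖ = 2 → ‖y + c‖ = 2 ∧ ‖y + d‖ = 2 ∧ ‖y + e‖ = 2 := by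
      intro y hy h
      have h1 := hne y hy h
      have h2 := hmcd y hy h1.1
      exact ⟨h2.1, h2.2, h1.2⟩
    have hnn : ‖n + n‖ = 2 := ((hpol n).1 hnG).2 n hnG
    obtain ⟨f, hf, f1, f2⟩ := exists_common_support hn1 (hn c hc) (dom n hn1 hnn).1
    obtain ⟨z1n, z1f⟩ := norm_combo_eq_one hn1 (hn c hc) hf f1 f2 hhalf hhalf hhs
    have z1d := (dom _ z1n (norm_add_eq_two z1n hn1 hf z1f f1)).2.1
    obtain ⟨f', hf', g1, g2⟩ := exists_common_support z1n (hn d hd) z1d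
    have hval : f' n = 1 ∧ f' c = 1 := by
      have h1 := hf' n
      have h2 := hf' c
      rw [hn1] at h1
      rw [hn c hc] at h2
      simp only [map_add, map_smul, smul_eq_mul] at g1
      constructor <;> linarith
    obtain ⟨z2n, z2f⟩ := norm_combo_eq_one z1n (hn d hd) hf' g1 g2 hhalf hhalf hhs
    have z2e := (dom _ z2n (norm_add_eq_two z2n hn1 hf' z2f hval.1)).2.2
    obtain ⟨f'', hf'', k1, k2⟩ := exists_common_support z2n (hn e he) z2e
    have h1 := hf'' n
    have h2 := hf'' c
    have h3 := hf'' d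
    rw [hn1] at h1
    rw [hn c hc] at h2
    rw [hn d hd] at h3
    simp only [map_add, map_smul, smul_eq_mul] at k1
    exact ⟨f'', hf'', by linarith, by linarith, k2⟩
  refine ⟨⟨hne, ?_, fun g hg => by simpa using hn g hg⟩, ?_⟩
  · intro c hc d hd s t hs ht hst
    refine (hpol _).2 ⟨?_, fun e he => ?_⟩
    · obtain ⟨f, hf, f1, f2, -⟩ := key c hc d hd c hc
      exact (norm_combo_eq_one (hn c hc) (hn d hd) hf f1 f2 hs ht hst).1
    · obtain ⟨f, hf, f1, f2, f3⟩ := key c hc d hd e he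
      obtain ⟨h1, h2⟩ := norm_combo_eq_one (hn c hc) (hn d hd) hf f1 f2 hs ht hst
      exact norm_add_eq_two h1 (hn e he) hf h2 f3
  · rintro D ⟨-, hDc, hDs⟩ hGD y hy
    refine (hpol y).2 ⟨by simpa using hDs hy, fun g hg => ?_⟩
    have h := hDs (hDc hy (hGD hg) hhalf hhalf hhs)
    rw [← smul_add, mem_sphere_zero_iff_norm, norm_smul, Real.norm_of_nonneg hhalf] at h
    linarith

/-- Surjective isometries of unit spheres map faces onto faces. With `G = T(C)` and
`D = -T(-C)`, the equivalence `‖y + c‖ = 2 ↔ ‖T y - T (-c)‖ = 2` makes `G` and `D` polar to each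
other, and directedness forces `G = D`. -/
lemma IsSphereIsometry.image_face {T : E → F} (hT : IsSphereIsometry T) {C : Set E}
    (hC : IsSphereFace C) : IsSphereFace (T '' C) := by
  have star : ∀ y c, ‖y‖ = 1 → ‖c‖ = 1 → (‖T y + -T (-c)‖ = 2 ↔ ‖y + c‖ = 2) := by
    intro y c hy hc
    rw [← sub_eq_add_neg, hT.norm_sub y (-c) hy (by simpa using hc), sub_neg_eq_add]
  set D : Set F := (fun c => -T (-c)) '' C with hD
  have hnT : ∀ c ∈ C, ‖T c‖ = 1 := fun c hc => hT.norm_map c (hC.norm_eq hc)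
  have hnT' : ∀ c ∈ C, ‖-T (-c)‖ = 1 := fun c hc => by
    rw [norm_neg]; exact hT.norm_map _ (by simpa using hC.norm_eq hc)
  have polG : ∀ z, ‖z‖ = 1 → (∀ d ∈ D, ‖z + d‖ = 2) → z ∈ T '' C := by
    intro z hz h
    obtain ⟨y, hy, rfl⟩ := hT.surj z hz
    exact ⟨y, hC.mem_iff.2 ⟨hy, fun c hc =>
      (star y c hy (hC.norm_eq hc)).1 (h _ ⟨c, hc, rfl⟩)⟩, rfl⟩
  have surj' : ∀ z : F, ‖z‖ = 1 → ∃ y, ‖y‖ = 1 ∧ -T (-y) = z := by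
    intro z hz
    obtain ⟨y, hy, h⟩ := hT.surj (-z) (by simpa using hz)
    exact ⟨-y, by simpa using hy, by simp [h]⟩
  have polD : ∀ z, ‖z‖ = 1 → (∀ g ∈ T '' C, ‖z + g‖ = 2) → z ∈ D := by
    intro z hz h
    obtain ⟨y, hy, rfl⟩ := surj' z hz
    refine ⟨y, hC.mem_iff.2 ⟨hy, fun c hc => ?_⟩, rfl⟩
    rw [add_comm]
    refine (star c y (hC.norm_eq hc) hy).1 ?_
    rw [add_comm]
    exact h _ ⟨c, hc, rfl⟩
  have dirD : ∀ c ∈ D, ∀ d ∈ D, ∃ m ∈ D, ∀ y, ‖y‖ = 1 → ‖y + m‖ = 2 →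
      ‖y + c‖ = 2 ∧ ‖y + d‖ = 2 := by
    rintro _ ⟨c, hc, rfl⟩ _ ⟨d, hd, rfl⟩
    obtain ⟨m, hm, h⟩ := hC.directed hc hd
    refine ⟨_, ⟨m, hm, rfl⟩, fun z hz hzm => ?_⟩
    obtain ⟨y, hy, rfl⟩ := hT.surj z hz
    have := h y hy ((star y m hy (hC.norm_eq hm)).1 hzm)
    exact ⟨(star y c hy (hC.norm_eq hc)).2 this.1, (star y d hy (hC.norm_eq hd)).2 this.2⟩
  have dirG : ∀ c ∈ T '' C, ∀ d ∈ T '' C, ∃ m ∈ T '' C, ∀ y, ‖y‖ = 1 → ‖y + m‖ = 2 →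
      ‖y + c‖ = 2 ∧ ‖y + d‖ = 2 := by
    rintro _ ⟨c, hc, rfl⟩ _ ⟨d, hd, rfl⟩
    obtain ⟨m, hm, h⟩ := hC.directed hc hd
    refine ⟨_, ⟨m, hm, rfl⟩, fun z hz hzm => ?_⟩
    obtain ⟨y, hy, rfl⟩ := surj' z hz
    have star' : ∀ c ∈ C, (‖-T (-y) + T c‖ = 2 ↔ ‖y + c‖ = 2) := fun c hc => by
      rw [add_comm, star c y (hC.norm_eq hc) hy, add_comm]
    have := h y hy ((star' m hm).1 hzm)
    exact ⟨(star' c hc).2 this.1, (star' d hd).2 this.2⟩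
  have pair : ∀ S : Set F, (∀ s ∈ S, ‖s‖ = 1) → (∀ c ∈ S, ∀ d ∈ S, ∃ m ∈ S, ∀ y, ‖y‖ = 1 →
      ‖y + m‖ = 2 → ‖y + c‖ = 2 ∧ ‖y + d‖ = 2) → ∀ c ∈ S, ∀ d ∈ S, ‖c + d‖ = 2 := by
    intro S hS hdir c hc d hd
    obtain ⟨m, hm, h⟩ := hdir c hc d hd
    have hmm : ‖m + m‖ = 2 := by rw [← two_smul ℝ, norm_smul, hS m hm]; norm_num
    have h1 := (h m (hS m hm) hmm).1
    rw [add_comm] at h1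
    exact (h c (hS c hc) h1).2
  have hnG : ∀ s ∈ T '' C, ‖s‖ = 1 := by rintro _ ⟨c, hc, rfl⟩; exact hnT c hc
  have hnD : ∀ s ∈ D, ‖s‖ = 1 := by rintro _ ⟨c, hc, rfl⟩; exact hnT' c hc
  have hDG : D = T '' C := by
    apply Set.Subset.antisymm
    · exact fun d hd => polG d (hnD d hd) fun e he => pair D hnD dirD d hd e he
    · exact fun d hd => polD d (hnG d hd) fun e he => pair _ hnG dirG d hd e he
  refine isSphereFace_of_polar (hC.nonempty.image T) (fun y => ⟨fun hy => ⟨hnG y hy,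
    fun g hg => pair _ hnG dirG y hy g hg⟩, fun h => ?_⟩) dirG
  exact polG y h.1 (by rw [hDG]; exact h.2)

end Faces

lemma IsSphereIsometry.exists_inverse {E F : Type*} [NormedAddCommGroup E] [NormedAddCommGroup F]
    {T : E → F} (hT : IsSphereIsometry T) :
    ∃ S : F → E, IsSphereIsometry S ∧ (∀ a, ‖a‖ = 1 → S (T a) = a) ∧
      ∀ b, ‖b‖ = 1 → T (S b) = b := by
  classical
  choose! S hS1 hS2 using hT.surj
  have hinv : ∀ a, ‖a‖ = 1 → S (T a) = a := by
    intro a ha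
    have h := hT.norm_sub _ _ (hS1 _ (hT.norm_map a ha)) ha
    rw [hS2 _ (hT.norm_map a ha), sub_self, norm_zero] at h
    exact sub_eq_zero.1 (norm_eq_zero.1 h.symm)
  refine ⟨S, ⟨hS1, fun a b ha hb => ?_, fun a ha => ⟨T a, hT.norm_map a ha, hinv a ha⟩⟩,
    hinv, hS2⟩
  rw [← hT.norm_sub _ _ (hS1 a ha) (hS1 b hb), hS2 a ha, hS2 b hb]

/-! ### Faces cut out by complex functionals -/

section ComplexFaces

variable {E : Type*} [NormedAddCommGroup E] [NormedSpace ℂ E]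

lemma convex_unit_slice {p : E →L[ℂ] ℂ} (hp : ∀ z, ‖p z‖ ≤ ‖z‖) {l : ℂ} (hl : ‖l‖ = 1) :
    Convex ℝ {a : E | ‖a‖ = 1 ∧ p a = l} := by
  rintro a ⟨ha, hpa⟩ b ⟨hb, hpb⟩ s t hs ht hst
  have hv : p (s • a + t • b) = l := by
    rw [map_add, ← Complex.coe_smul s a, ← Complex.coe_smul t b, map_smul, map_smul, hpa, hpb,
      smul_eq_mul, smul_eq_mul, ← add_mul]
    rw [← Complex.ofReal_add, hst, Complex.ofReal_one, one_mul]
  refine ⟨le_antisymm ?_ ?_, hv⟩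
  · refine (norm_add_le _ _).trans ?_
    rw [norm_smul, norm_smul, Real.norm_of_nonneg hs, Real.norm_of_nonneg ht, ha, hb]
    linarith
  · have := hp (s • a + t • b)
    rwa [hv, hl] at this

lemma IsSphereFace.mem_iff_of_forall {C : Set E} (hC : IsSphereFace C) {p : E →L[ℂ] ℂ}
    (hp : ∀ z, ‖p z‖ ≤ ‖z‖) {l : ℂ} (hl : ‖l‖ = 1) (h : ∀ c ∈ C, p c = l) {a : E} :
    a ∈ C ↔ ‖a‖ = 1 ∧ p a = l := by
  refine ⟨fun ha => ⟨hC.norm_eq ha, h a ha⟩, fun ha => ?_⟩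
  exact hC.le_of_ge ⟨⟨a, ha⟩, convex_unit_slice hp hl, fun b hb => by simpa using hb.1⟩
    (fun c hc => ⟨hC.norm_eq hc, h c hc⟩) ha

lemma IsSphereFace.exists_functional {C : Set E} (hC : IsSphereFace C) :
    ∃ q : E →L[ℂ] ℂ, (∀ z, ‖q z‖ ≤ ‖z‖) ∧ ∀ b, b ∈ C ↔ ‖b‖ = 1 ∧ q b = 1 := by
  obtain ⟨f, u, hfu, huf⟩ := RCLike.geometric_hahn_banach_open (𝕜 := ℂ)
    (convex_ball (0 : E) 1) Metric.isOpen_ball hC.convex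
    (Set.disjoint_left.2 fun z hz hzC => by
      rw [mem_ball_zero_iff, hC.norm_eq hzC] at hz
      exact lt_irrefl _ hz)
  have hu : 0 < u := by simpa using hfu 0 (by simp)
  have hre : ∀ z, (f z).re ≤ u * ‖z‖ := by
    intro z
    refine le_of_forall_pos_le_add fun ε hε => ?_
    have hpos : 0 < ‖z‖ + ε / u := by positivity
    have hz : ((‖z‖ + ε / u : ℝ) : ℂ)⁻¹ • z ∈ Metric.ball (0 : E) 1 := by
      rw [mem_ball_zero_iff, norm_smul, norm_inv, Complex.norm_real, Real.norm_of_nonneg hpos.le,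
        inv_mul_lt_iff₀ hpos, mul_one]
      linarith [div_pos hε hu]
    have h := hfu _ hz
    rw [map_smul, smul_eq_mul, ← Complex.ofReal_inv] at h
    simp only [RCLike.re_to_complex, Complex.re_ofReal_mul] at h
    rw [inv_mul_lt_iff₀ hpos] at h
    have : (‖z‖ + ε / u) * u = u * ‖z‖ + ε := by field_simp
    linarith
  have hnorm : ∀ z, ‖f z‖ ≤ u * ‖z‖ := by
    intro z
    by_cases h0 : f z = 0
    · rw [h0, norm_zero]; positivity
    have h0' : (‖f z‖ : ℂ) ≠ 0 := by simpa using h0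
    -- rotate `z` so that `f` becomes real and nonnegative on it
    have h := hre ((starRingEnd ℂ (f z) / ‖f z‖) • z)
    have hval : starRingEnd ℂ (f z) / ‖f z‖ * f z = (‖f z‖ : ℂ) := by
      rw [div_mul_eq_mul_div, Complex.conj_mul', div_eq_iff h0', sq]
    rw [map_smul, smul_eq_mul, hval, Complex.ofReal_re, norm_smul, norm_div, Complex.norm_real,
      norm_norm, RCLike.norm_conj, div_self (by simpa using h0), one_mul] at h
    exact h
  have hu' : ((u : ℝ) : ℂ) ≠ 0 := by exact_mod_cast hu.ne'
  have hq : ∀ z, ‖((u : ℂ)⁻¹ • f) z‖ ≤ ‖z‖ := by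
    intro z
    rw [smul_apply, norm_smul, norm_inv, Complex.norm_real,
      Real.norm_of_nonneg hu.le, inv_mul_le_iff₀ hu]
    exact hnorm z
  refine ⟨(u : ℂ)⁻¹ • f, hq, fun b => hC.mem_iff_of_forall hq norm_one fun c hc => ?_⟩
  have h1 := huf c hc
  have h2 := hq c
  rw [hC.norm_eq hc] at h2
  have h3 : 1 ≤ (((u : ℂ)⁻¹ • f) c).re := by
    rw [smul_apply, smul_eq_mul, ← Complex.ofReal_inv, Complex.re_ofReal_mul,
      le_inv_mul_iff₀ hu, mul_one]
    exact h1
  set w := ((u : ℂ)⁻¹ • f) c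
  have h4 : w.re * w.re + w.im * w.im ≤ 1 := by
    rw [← Complex.normSq_apply, Complex.normSq_eq_norm_sq]
    nlinarith [norm_nonneg w]
  apply Complex.ext
  · rw [Complex.one_re]; nlinarith [mul_self_nonneg w.im]
  · rw [Complex.one_im]; exact mul_self_eq_zero.1 (le_antisymm (by nlinarith) (mul_self_nonneg _))

lemma isSphereIsometry_smul {γ : ℂ} (hγ : ‖γ‖ = 1) : IsSphereIsometry (fun a : E => γ • a) where
  norm_map a ha := by rw [norm_smul, hγ, ha, one_mul]
  norm_sub a b _ _ := by rw [← smul_sub, norm_smul, hγ, one_mul]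
  surj b hb := ⟨γ⁻¹ • b, by rw [norm_smul, norm_inv, hγ, hb, inv_one, one_mul], by
    rw [smul_smul, mul_inv_cancel₀ (norm_ne_zero_iff.1 (by rw [hγ]; exact one_ne_zero)), one_smul]⟩

end ComplexFaces

/-! ### Peaking functions in a closed subalgebra -/

section Peaking

variable {X : Type*} [TopologicalSpace X] [CompactSpace X] {A : Subalgebra ℂ C(X, ℂ)}

lemma norm_apply_le_norm (a : A) (y : X) : ‖a.1 y‖ ≤ ‖a‖ := a.1.norm_coe_le_norm y

lemma norm_le_of_forall_apply {a : A} {r : ℝ} (hr : 0 ≤ r) (h : ∀ y, ‖a.1 y‖ ≤ r) : ‖a‖ ≤ r :=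
  (ContinuousMap.norm_le _ hr).2 h

lemma exists_norm_apply_eq_one {a : A} (ha : ‖a‖ = 1) : ∃ y, ‖a.1 y‖ = 1 := by
  have hne : Nonempty X := by
    by_contra h
    rw [not_nonempty_iff] at h
    have := norm_le_of_forall_apply (a := a) le_rfl (fun y => h.elim y)
    linarith
  obtain ⟨y, -, hy⟩ := isCompact_univ.exists_isMaxOn Set.univ_nonempty
    (a.1.continuous.norm.continuousOn)
  refine ⟨y, le_antisymm ((norm_apply_le_norm a y).trans ha.le) ?_⟩
  rw [← ha]
  exact norm_le_of_forall_apply (norm_nonneg _) fun z => hy (Set.mem_univ z)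

variable (A) in
/-- Evaluation at a point, as a functional on the subalgebra. -/
noncomputable def evalAt (x : X) : A →L[ℂ] ℂ :=
  LinearMap.mkContinuous
    { toFun := fun a => a.1 x
      map_add' := fun _ _ => rfl
      map_smul' := fun _ _ => rfl } 1 (fun a => (norm_apply_le_norm a x).trans_eq (one_mul _).symm)

/-- The uniform version of separation: off a neighbourhood of `K` a function peaking on `K` can be
made uniformly small. -/
lemma exists_small_off_isOpen {K U : Set X} (hK : ∀ z ∉ K, ∃ a : A, ‖a‖ ≤ 1 ∧
    (∀ y ∈ K, a.1 y = 1) ∧ a.1 z ≠ 1) (hU : IsOpen U) (hKU : K ⊆ U) {δ : ℝ} (hδ : 0 < δ) :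
    ∃ a : A, ‖a‖ ≤ 1 ∧ (∀ y ∈ K, a.1 y = 1) ∧ ∀ z ∉ U, ‖a.1 z‖ ≤ δ := by
  have hone : ‖(1 : A)‖ ≤ 1 := norm_le_of_forall_apply zero_le_one fun y => by simp
  refine hU.isClosed_compl.isCompact.induction_on (p := fun s => ∃ a : A, ‖a‖ ≤ 1 ∧
    (∀ y ∈ K, a.1 y = 1) ∧ ∀ z ∈ s, ‖a.1 z‖ ≤ δ) ?_ ?_ ?_ ?_
  · exact ⟨1, hone, fun y _ => by simp, by simp⟩
  · rintro s t hst ⟨a, h1, h2, h3⟩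
    exact ⟨a, h1, h2, fun z hz => h3 z (hst hz)⟩
  · rintro s t ⟨a, h1, h2, h3⟩ ⟨b, k1, k2, k3⟩
    refine ⟨a * b, (norm_mul_le a b).trans (mul_le_one₀ h1 (norm_nonneg b) k1), fun y hy => ?_,
      fun z hz => ?_⟩
    · simp [h2 y hy, k2 y hy]
    · have ha := (norm_apply_le_norm a z).trans h1
      have hb := (norm_apply_le_norm b z).trans k1
      have : ‖(a * b).1 z‖ = ‖a.1 z‖ * ‖b.1 z‖ := by simp
      rw [this]
      rcases hz with hz | hz
      · nlinarith [h3 z hz, norm_nonneg (a.1 z), norm_nonneg (b.1 z)]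
      · nlinarith [k3 z hz, norm_nonneg (a.1 z), norm_nonneg (b.1 z)]
  · intro z hz
    obtain ⟨a, h1, h2, h3⟩ := hK z fun hzK => hz (hKU hzK)
    have haz := (norm_apply_le_norm a z).trans h1
    -- averaging with `1` turns `a z ≠ 1` into a modulus below `1`
    set b : A := (1 / 2 : ℂ) • (1 + a) with hb
    have hbv : ∀ y, b.1 y = (1 / 2 : ℂ) * (1 + a.1 y) := fun _ => rfl
    have hb1 : ‖b‖ ≤ 1 := by
      refine norm_le_of_forall_apply zero_le_one fun y => ?_
      have h4 : ‖(1 : ℂ) + a.1 y‖ ≤ 1 + 1 := (norm_add_le _ _).trans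
        (add_le_add norm_one.le ((norm_apply_le_norm a y).trans h1))
      rw [hbv, norm_mul]
      norm_num
      linarith
    have hbz : ‖b.1 z‖ < 1 := by
      have hne : ‖(1 : ℂ) + a.1 z‖ < 2 := by
        by_contra hcon
        apply h3
        have h4 : ‖(1 : ℂ) + a.1 z‖ ^ 2 ≥ 4 := by nlinarith [not_lt.1 hcon]
        have h5 : ‖a.1 z‖ ^ 2 ≤ 1 := by nlinarith [norm_nonneg (a.1 z)]
        rw [← Complex.normSq_eq_norm_sq, Complex.normSq_apply] at h4 h5
        simp only [Complex.add_re, Complex.one_re, Complex.add_im, Complex.one_im] at h4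
        apply Complex.ext
        · rw [Complex.one_re]; nlinarith [mul_self_nonneg (a.1 z).im]
        · rw [Complex.one_im]
          exact mul_self_eq_zero.1 (le_antisymm (by nlinarith [sq_nonneg ((a.1 z).re - 1)])
            (mul_self_nonneg _))
      rw [hbv, norm_mul]
      norm_num
      linarith
    obtain ⟨n, hn⟩ := exists_pow_lt_of_lt_one hδ hbz
    have hcont : Continuous fun y => ‖(b ^ n).1 y‖ := (b ^ n).1.continuous.norm
    refine ⟨{y | ‖(b ^ n).1 y‖ < δ}, mem_nhdsWithin_of_mem_nhds
      ((isOpen_lt hcont continuous_const).mem_nhds ?_), b ^ n, ?_, fun y hy => ?_,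
      fun y hy => le_of_lt hy⟩
    · simpa using hn
    · refine norm_le_of_forall_apply zero_le_one fun y => ?_
      have : ‖(b ^ n).1 y‖ = ‖b.1 y‖ ^ n := by simp
      rw [this]
      exact pow_le_one₀ (norm_nonneg _) ((norm_apply_le_norm b y).trans hb1)
    · have : (b ^ n).1 y = (b.1 y) ^ n := by simp
      rw [this, hbv, h2 y hy]
      norm_num

/-- Bishop's construction: the decay of a peaking function can dominate any prescribed continuous
function. The witness is `∑ 2 ^ (-(k + 1)) • h k`, where `h k` is small where
`g ≥ (1 - δ) * 2 ^ (-(k + 1))`. -/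
lemma exists_peaking_dominating [CompleteSpace A] {K : Set X} (hK : ∀ z ∉ K, ∃ a : A, ‖a‖ ≤ 1 ∧
    (∀ y ∈ K, a.1 y = 1) ∧ a.1 z ≠ 1) {g : X → ℝ} (hg : Continuous g) (hgK : ∀ y ∈ K, g y ≤ 0)
    {δ : ℝ} (hδ : 0 < δ) (hδ1 : δ < 1) (hgδ : ∀ y, g y ≤ 1 - δ) :
    ∃ h : A, ‖h‖ ≤ 1 ∧ (∀ y ∈ K, h.1 y = 1) ∧ ∀ y, ‖h.1 y‖ ≤ 1 - g y := by
  have hδ2 : 0 < 1 - δ := by linarith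
  have hpeak : ∀ k : ℕ, ∃ a : A, ‖a‖ ≤ 1 ∧ (∀ y ∈ K, a.1 y = 1) ∧
      ∀ z ∉ {y | g y < (1 - δ) * (1 / 2) ^ (k + 1)}, ‖a.1 z‖ ≤ δ := fun k =>
    exists_small_off_isOpen hK (isOpen_lt hg continuous_const)
      (fun y hy => (hgK y hy).trans_lt (by positivity)) hδ
  choose a ha1 haK has using hpeak
  have hgeo : HasSum (fun k : ℕ => (1 / 2 : ℝ) ^ (k + 1)) 1 := by
    have := hasSum_geometric_two.mul_left (1 / 2 : ℝ)
    norm_num at this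
    convert! this using 1
    ext k
    rw [pow_succ', one_div, inv_pow]
  have htail : ∀ n : ℕ, HasSum (fun k : ℕ => (1 / 2 : ℝ) ^ (k + n + 1)) ((1 / 2) ^ n) := fun n => by
    have := hgeo.mul_left ((1 / 2 : ℝ) ^ n)
    rw [mul_one] at this
    convert! this using 1
    ext k
    rw [← pow_add]
    congr 1
    ring
  have hterm : ∀ k y, ‖((((1 / 2 : ℂ) ^ (k + 1)) • a k : A)).1 y‖
      = (1 / 2) ^ (k + 1) * ‖(a k).1 y‖ := fun k y => by simp
  have hsum : Summable fun k : ℕ => ((1 / 2 : ℂ) ^ (k + 1)) • a k := by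
    refine Summable.of_norm_bounded hgeo.summable fun k => ?_
    refine norm_le_of_forall_apply (by positivity) fun y => ?_
    rw [hterm]
    exact mul_le_of_le_one_right (by positivity) ((norm_apply_le_norm _ y).trans (ha1 k))
  set h : A := ∑' k : ℕ, ((1 / 2 : ℂ) ^ (k + 1)) • a k with hh
  have hval : ∀ y, HasSum (fun k : ℕ => ((((1 / 2 : ℂ) ^ (k + 1)) • a k : A)).1 y) (h.1 y) :=
    fun y => hsum.hasSum.mapL (evalAt A y)
  have hle1 : ∀ y, ‖h.1 y‖ ≤ 1 := fun y => by
    rw [← (hval y).tsum_eq]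
    refine tsum_of_norm_bounded hgeo fun k => ?_
    rw [hterm]
    exact mul_le_of_le_one_right (by positivity) ((norm_apply_le_norm _ y).trans (ha1 k))
  refine ⟨h, norm_le_of_forall_apply zero_le_one hle1, fun y hy => ?_, fun y => ?_⟩
  · refine (hval y).unique ?_
    have := Complex.hasSum_ofReal.2 hgeo
    convert! this using 1
    · ext k
      simp [haK k y hy]
  · rcases le_or_gt (g y) 0 with h0 | h0
    · linarith [hle1 y]
    have hex : ∃ n : ℕ, (1 - δ) * (1 / 2) ^ (n + 1) ≤ g y := by
      obtain ⟨n, hn⟩ := exists_pow_lt_of_lt_one h0 (by norm_num : (1 / 2 : ℝ) < 1)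
      refine ⟨n, le_trans ?_ hn.le⟩
      rw [pow_succ]
      have : (0 : ℝ) < (1 / 2) ^ n := by positivity
      nlinarith
    classical
    set n := Nat.find hex with hn
    have hgn : g y ≤ (1 - δ) * (1 / 2) ^ n := by
      rcases Nat.eq_zero_or_pos n with h1 | h1
      · rw [h1, pow_zero, mul_one]; exact hgδ y
      · have := Nat.find_min hex (m := n - 1) (by omega)
        rw [Nat.sub_add_cancel h1] at this
        exact (not_le.1 this).le
    have hsmall : ∀ k, ‖(a (k + n)).1 y‖ ≤ δ := fun k => by
      refine has (k + n) y ?_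
      rw [Set.mem_ofPred_eq, not_lt]
      refine le_trans ?_ (Nat.find_spec hex)
      refine mul_le_mul_of_nonneg_left ?_ hδ2.le
      exact pow_le_pow_of_le_one (by norm_num) (by norm_num) (by omega)
    have hgn' : HasSum (fun k : ℕ => if k < n then (1 / 2 : ℝ) ^ (k + 1)
        else δ * (1 / 2) ^ (k + 1)) (1 - (1 - δ) * (1 / 2) ^ n) := by
      have h1 : HasSum (fun k : ℕ => if k < n then 0 else (1 - δ) * (1 / 2 : ℝ) ^ (k + 1))
          ((1 - δ) * (1 / 2) ^ n) := by
        rw [← hasSum_nat_add_iff' n, Finset.sum_eq_zero, sub_zero]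
        · convert! (htail n).mul_left (1 - δ) using 1
          ext k
          simp
        · intro k hk
          simp [Finset.mem_range.1 hk]
      convert! hgeo.sub h1 using 1
      ext k
      split_ifs <;> ring
    have : ‖h.1 y‖ ≤ 1 - (1 - δ) * (1 / 2) ^ n := by
      rw [← (hval y).tsum_eq]
      refine tsum_of_norm_bounded hgn' fun k => ?_
      rw [hterm]
      split_ifs with hk
      · exact mul_le_of_le_one_right (by positivity) ((norm_apply_le_norm _ y).trans (ha1 k))
      · rw [mul_comm]
        refine mul_le_mul_of_nonneg_right ?_ (by positivity)
        have := hsmall (k - n)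
        rwa [Nat.sub_add_cancel (not_lt.1 hk)] at this
    linarith

end Peaking

/-! ### Faces of a uniform algebra -/

section PointFaces

variable {X : Type*} [TopologicalSpace X] [CompactSpace X] {A : Subalgebra ℂ C(X, ℂ)}

variable (A) in
/-- The slice of the unit sphere of functions with value `l` at `x`. -/
def pointSlice (x : X) (l : ℂ) : Set A := {a | ‖a‖ = 1 ∧ a.1 x = l}

variable (A) in
/-- The points at which every other point can be excluded by a norm-one function with value `1`;
in a uniform algebra these are the strong boundary points. -/
def IsPeakingPoint (x : X) : Prop := ∀ z ≠ x, ∃ a : A, ‖a‖ ≤ 1 ∧ a.1 x = 1 ∧ a.1 z ≠ 1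

lemma norm_eq_one_of_apply {a : A} (ha : ‖a‖ ≤ 1) {x : X} (hx : ‖a.1 x‖ = 1) : ‖a‖ = 1 :=
  le_antisymm ha (hx ▸ norm_apply_le_norm a x)

/-- By convexity, finitely many elements of a face share a point at which they take a common
unimodular value; compactness of `X` does the rest. -/
lemma IsSphereFace.exists_eq_pointSlice {C : Set A} (hC : IsSphereFace C) :
    ∃ x l, ‖l‖ = 1 ∧ C = pointSlice A x l := by
  obtain ⟨c₀, hc₀⟩ := hC.nonempty
  have hle : ∀ c ∈ C, ∀ y, ‖c.1 y‖ ≤ 1 := fun c hc y =>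
    (norm_apply_le_norm c y).trans (hC.norm_eq hc).le
  have mid : ∀ c ∈ C, ∀ d ∈ C, ∃ m ∈ C, ∀ y, m.1 y = (c.1 y + d.1 y) / 2 := by
    intro c hc d hd
    refine ⟨_, hC.convex hc hd (by norm_num : (0 : ℝ) ≤ 1 / 2)
      (by norm_num : (0 : ℝ) ≤ 1 / 2) (by norm_num), fun y => ?_⟩
    have h : ((1 / 2 : ℝ) • c + (1 / 2 : ℝ) • d : A) = (1 / 2 : ℂ) • c + (1 / 2 : ℂ) • d := by
      rw [← Complex.coe_smul, ← Complex.coe_smul]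
      norm_num
    rw [h]
    change (1 / 2 : ℂ) * c.1 y + (1 / 2 : ℂ) * d.1 y = _
    ring
  have strict : ∀ u v : ℂ, ‖u‖ ≤ 1 → ‖v‖ ≤ 1 → ‖(u + v) / 2‖ = 1 → ‖u‖ = 1 ∧ u = v := by
    intro u v hu hv h
    have h2 : ‖u + v‖ = 2 := by
      rw [norm_div] at h
      norm_num at h
      linarith
    have hu1 : ‖u‖ = 1 := by linarith [norm_add_le u v]
    have hv1 : ‖v‖ = 1 := by linarith [norm_add_le u v]
    refine ⟨hu1, eq_of_norm_eq_of_norm_add_eq (hu1.trans hv1.symm) ?_⟩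
    rw [h2, hu1, hv1]
    norm_num
  let Y : C → Set X := fun c => {y | c.1.1 y = c₀.1 y} ∩ {y | ‖c₀.1 y‖ = 1}
  have hYc : ∀ c, IsClosed (Y c) := fun c =>
    (isClosed_eq c.1.1.continuous c₀.1.continuous).inter
      (isClosed_eq c₀.1.continuous.norm continuous_const)
  have hne : Nonempty C := ⟨⟨c₀, hc₀⟩⟩
  obtain ⟨x, hx⟩ := IsCompact.nonempty_iInter_of_directed_nonempty_isCompact_isClosed Y (by
      rintro ⟨c, hc⟩ ⟨d, hd⟩
      obtain ⟨m, hm, hmy⟩ := mid c hc d hd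
      have : ∀ y ∈ Y ⟨m, hm⟩, c.1 y = c₀.1 y ∧ d.1 y = c₀.1 y := by
        rintro y ⟨h1, h2⟩
        rw [Set.mem_ofPred_eq, hmy] at h1
        have h3 := (strict _ _ (hle c hc y) (hle d hd y) (by rw [h1]; exact h2)).2
        rw [← h3] at h1 ⊢
        have : c.1 y = c₀.1 y := by rw [← h1]; ring
        exact ⟨this, this⟩
      exact ⟨⟨m, hm⟩, fun y hy => ⟨(this y hy).1, hy.2⟩, fun y hy => ⟨(this y hy).2, hy.2⟩⟩)
    (by
      rintro ⟨c, hc⟩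
      obtain ⟨m, hm, hmy⟩ := mid c hc c₀ hc₀
      obtain ⟨y, hy⟩ := exists_norm_apply_eq_one (hC.norm_eq hm)
      rw [hmy] at hy
      have h := strict _ _ (hle c hc y) (hle c₀ hc₀ y) hy
      refine ⟨y, h.2, ?_⟩
      rw [Set.mem_ofPred_eq, ← h.2]
      exact h.1)
    (fun c => (hYc c).isCompact) hYc
  rw [Set.mem_iInter] at hx
  have hx0 : ‖c₀.1 x‖ = 1 := (hx ⟨c₀, hc₀⟩).2
  refine ⟨x, c₀.1 x, hx0, Set.ext fun a => ?_⟩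
  exact hC.mem_iff_of_forall (p := evalAt A x) (fun z => norm_apply_le_norm z x) hx0
    fun c hc => (hx ⟨c, hc⟩).1

lemma smul_image_pointSlice {γ l : ℂ} (hγ : ‖γ‖ = 1) (x : X) :
    (fun a : A => γ • a) '' pointSlice A x l = pointSlice A x (γ * l) := by
  have h0 : γ ≠ 0 := norm_ne_zero_iff.1 (by rw [hγ]; exact one_ne_zero)
  ext a
  constructor
  · rintro ⟨b, ⟨h1, h2⟩, rfl⟩
    refine ⟨by simp only [norm_smul, hγ, h1, one_mul], ?_⟩
    change γ * b.1 x = _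
    rw [h2]
  · rintro ⟨h1, h2⟩
    refine ⟨γ⁻¹ • a, ⟨by simp only [norm_smul, norm_inv, hγ, h1, inv_one, one_mul], ?_⟩, ?_⟩
    · change γ⁻¹ * a.1 x = _
      rw [h2, inv_mul_cancel_left₀ h0]
    · simp only [smul_smul, mul_inv_cancel₀ h0, one_smul]

lemma isSphereFace_pointSlice {x : X} {l m : ℂ} (hl : ‖l‖ = 1) (hm : ‖m‖ = 1)
    (h : IsSphereFace (pointSlice A x l)) : IsSphereFace (pointSlice A x m) := by
  have h0 : l ≠ 0 := norm_ne_zero_iff.1 (by rw [hl]; exact one_ne_zero)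
  have hγ : ‖m / l‖ = 1 := by rw [norm_div, hl, hm, div_one]
  have := (isSphereIsometry_smul (E := A) hγ).image_face h
  rwa [smul_image_pointSlice hγ, div_mul_cancel₀ _ h0] at this

/-- If `pointSlice A x 1` is a face then all functions in it take the value `1` on the set `K` of
points that they fail to distinguish from `x`, and by maximality each point of `K` defines the same
face. A function that is not constant on `K`, normalised to attain its maximum `1` over `K`, can be
averaged with a function peaking on `K` to give an element of the face of one point of `K` that
does not belong to the face of another. -/
lemma IsSphereFace.isPeakingPoint [CompleteSpace A] (hA : A.SeparatesPoints) {x : X}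
    (hx : IsSphereFace (pointSlice A x 1)) : IsPeakingPoint A x := by
  intro z hzx
  by_contra! hcon
  let K : Set X := {y | ∀ a : A, ‖a‖ ≤ 1 → a.1 x = 1 → a.1 y = 1}
  have hKclosed : IsClosed K := by
    have : K = ⋂ (a : A) (_ : ‖a‖ ≤ 1) (_ : a.1 x = 1), {y | a.1 y = 1} := by
      ext y
      simp only [K, Set.mem_iInter, Set.mem_ofPred_eq]
    rw [this]
    exact isClosed_iInter fun a => isClosed_iInter fun _ => isClosed_iInter fun _ =>
      isClosed_eq a.1.continuous continuous_const
  have hxK : x ∈ K := fun a _ h => h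
  have hK : ∀ w ∉ K, ∃ a : A, ‖a‖ ≤ 1 ∧ (∀ y ∈ K, a.1 y = 1) ∧ a.1 w ≠ 1 := by
    intro w hw
    simp only [K, Set.mem_ofPred_eq, not_forall] at hw
    obtain ⟨a, h1, h2, h3⟩ := hw
    exact ⟨a, h1, fun y hy => hy a h1 h2, h3⟩
  obtain ⟨_, ⟨f₀, hf₀, rfl⟩, hsep⟩ := hA hzx
  set f₁ : A := ⟨f₀, hf₀⟩ - (f₀ z) • 1 with hf₁
  have hf₁v : ∀ y, f₁.1 y = f₀ y - f₀ z := fun y => by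
    change f₀ y - f₀ z * 1 = _
    rw [mul_one]
  obtain ⟨y₁, hy₁K, hy₁⟩ := hKclosed.isCompact.exists_isMaxOn ⟨x, hxK⟩
    f₁.1.continuous.norm.continuousOn
  have hM : 0 < ‖f₁.1 y₁‖ := by
    refine lt_of_lt_of_le ?_ (hy₁ hxK)
    rw [norm_pos_iff, hf₁v]
    exact sub_ne_zero.2 fun h => hsep h.symm
  set f : A := (f₁.1 y₁)⁻¹ • f₁ with hf
  have hfv : ∀ y, f.1 y = (f₁.1 y₁)⁻¹ * f₁.1 y := fun _ => rfl
  have hfy₁ : f.1 y₁ = 1 := by rw [hfv, inv_mul_cancel₀ (norm_pos_iff.1 hM)]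
  have hfz : f.1 z = 0 := by rw [hfv, hf₁v z, sub_self, mul_zero]
  have hfK : ∀ y ∈ K, ‖f.1 y‖ ≤ 1 := fun y hy => by
    rw [hfv, norm_mul, norm_inv, inv_mul_le_iff₀ hM, mul_one]
    exact hy₁ hy
  set ε : ℝ := 1 / (2 * (‖f‖ + 1)) with hε
  have hN : 0 ≤ ‖f‖ := norm_nonneg f
  have hε0 : 0 < ε := by positivity
  have hεN : ε * (‖f‖ + 1) = 1 / 2 := by rw [hε]; field_simp
  have hε1 : ε ≤ 1 / 2 := by nlinarith
  have hε2 : 0 < 1 - ε := by linarith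
  obtain ⟨h, h1, hK1, hg⟩ := exists_peaking_dominating hK
    (g := fun y => ε * (‖f.1 y‖ - 1) / (1 - ε))
    ((continuous_const.mul (f.1.continuous.norm.sub continuous_const)).div_const _)
    (fun y hy => div_nonpos_of_nonpos_of_nonneg
      (mul_nonpos_of_nonneg_of_nonpos hε0.le (by linarith [hfK y hy])) hε2.le)
    (δ := 1 / 2) (by norm_num) (by norm_num) (fun y => by
      rw [div_le_iff₀ hε2]
      nlinarith [norm_apply_le_norm f y])
  set b : A := (ε : ℂ) • f + ((1 - ε : ℝ) : ℂ) • h with hb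
  have hbv : ∀ y, b.1 y = ε * f.1 y + ((1 - ε : ℝ) : ℂ) * h.1 y := fun _ => rfl
  have hb1 : ‖b‖ ≤ 1 := norm_le_of_forall_apply zero_le_one fun y => by
    rw [hbv]
    refine (norm_add_le _ _).trans ?_
    rw [norm_mul, norm_mul, Complex.norm_real, Complex.norm_real, Real.norm_of_nonneg hε0.le,
      Real.norm_of_nonneg hε2.le]
    have h2 := mul_le_mul_of_nonneg_left (hg y) hε2.le
    have h3 : (1 - ε) * (1 - ε * (‖f.1 y‖ - 1) / (1 - ε)) = 1 - ε * ‖f.1 y‖ := by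
      field_simp
      ring
    linarith
  have hby₁ : b.1 y₁ = 1 := by
    rw [hbv, hfy₁, hK1 y₁ hy₁K]
    push_cast
    ring
  have hbx : b ∈ pointSlice A x 1 := by
    refine (hx.mem_iff_of_forall (p := evalAt A y₁) (fun z => norm_apply_le_norm z y₁) norm_one
      fun c hc => hy₁K c hc.1.le hc.2).2 ⟨norm_eq_one_of_apply hb1 (by rw [hby₁, norm_one]), hby₁⟩
  have hbz := hcon b hb1 hbx.2
  rw [hbv, hfz, hK1 z hcon, mul_zero, zero_add, mul_one] at hbz
  have : (1 - ε : ℝ) = 1 := by exact_mod_cast hbz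
  linarith

lemma IsPeakingPoint.exists_off {x : X} (hx : IsPeakingPoint A x) :
    ∀ z ∉ ({x} : Set X), ∃ a : A, ‖a‖ ≤ 1 ∧ (∀ y ∈ ({x} : Set X), a.1 y = 1) ∧ a.1 z ≠ 1 := by
  intro z hz
  obtain ⟨a, h1, h2, h3⟩ := hx z hz
  exact ⟨a, h1, by simpa using h2, h3⟩

lemma IsPeakingPoint.exists_small [T1Space X] {x z : X} (hx : IsPeakingPoint A x) (hz : z ≠ x)
    {δ : ℝ} (hδ : 0 < δ) : ∃ c : A, ‖c‖ = 1 ∧ c.1 x = 1 ∧ ‖c.1 z‖ ≤ δ := by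
  obtain ⟨c, h1, h2, h3⟩ := exists_small_off_isOpen hx.exists_off
    (isOpen_compl_singleton (x := z)) (by simpa using hz) hδ
  have h2 := h2 x rfl
  exact ⟨c, norm_eq_one_of_apply h1 (by rw [h2, norm_one]), h2, h3 z (by simp)⟩

/-- The distance from `a` to the face of functions with value `l` at `x`, where `l` is the phase of
`a x`, is at most `1 - |a x|`. -/
lemma IsPeakingPoint.exists_near_slice [CompleteSpace A] {x : X} (hx : IsPeakingPoint A x)
    {a : A} (ha : ‖a‖ = 1) {l : ℂ} (hl : ‖l‖ = 1) (hal : a.1 x = ‖a.1 x‖ * l) {ε : ℝ}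
    (hε : 0 < ε) (hε1 : ε < 1) :
    ∃ b : A, ‖b‖ = 1 ∧ b.1 x = l ∧ ‖a - b‖ ≤ 1 - ‖a.1 x‖ + 2 * ε := by
  set α : ℝ := ‖a.1 x‖ with hα
  have hα0 : 0 ≤ α := norm_nonneg _
  have hα1 : α ≤ 1 := (norm_apply_le_norm a x).trans ha.le
  set d : ℝ := 1 - (1 - ε) * α with hd
  have hd0 : 0 < d := by nlinarith
  have hd1 : d ≤ 1 := by nlinarith
  obtain ⟨h, h1, hx1, hg⟩ := exists_peaking_dominating hx.exists_off
    (g := fun y => (1 - ε) * (‖a.1 y‖ - α) / d)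
    ((continuous_const.mul (a.1.continuous.norm.sub continuous_const)).div_const _)
    (by rintro y rfl; simp [hα]) hε hε1 (fun y => by
      rw [div_le_iff₀ hd0]
      nlinarith [(norm_apply_le_norm a y).trans ha.le])
  have hx1 := hx1 x rfl
  set b : A := ((1 - ε : ℝ) : ℂ) • a + ((d : ℂ) * l) • h with hb
  have hbv : ∀ y, b.1 y = ((1 - ε : ℝ) : ℂ) * a.1 y + (d : ℂ) * l * h.1 y := fun _ => rfl
  have hb1 : ‖b‖ ≤ 1 := norm_le_of_forall_apply zero_le_one fun y => by
    rw [hbv]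
    refine (norm_add_le _ _).trans ?_
    rw [norm_mul, norm_mul, norm_mul, Complex.norm_real, Complex.norm_real, hl,
      Real.norm_of_nonneg hd0.le, Real.norm_of_nonneg (by linarith), mul_one]
    have h2 := mul_le_mul_of_nonneg_left (hg y) hd0.le
    have h3 : d * (1 - (1 - ε) * (‖a.1 y‖ - α) / d) = d - (1 - ε) * (‖a.1 y‖ - α) := by
      field_simp
    rw [h3] at h2
    linarith
  have hbx : b.1 x = l := by
    rw [hbv, hx1, hal, hd]
    push_cast
    ring
  refine ⟨b, norm_eq_one_of_apply hb1 (by rw [hbx, hl]), hbx,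
    norm_le_of_forall_apply (by linarith) fun y => ?_⟩
  have hab : (a - b).1 y = (ε : ℂ) * a.1 y - (d : ℂ) * l * h.1 y := by
    change a.1 y - b.1 y = _
    rw [hbv]
    push_cast
    ring
  rw [hab]
  refine (norm_sub_le _ _).trans ?_
  rw [norm_mul, norm_mul, norm_mul, Complex.norm_real, Complex.norm_real, hl,
    Real.norm_of_nonneg hd0.le, Real.norm_of_nonneg hε.le, mul_one]
  have h2 := (norm_apply_le_norm a y).trans ha.le
  have h3 := (norm_apply_le_norm h y).trans h1
  nlinarith

lemma exists_resolvent [CompleteSpace A] {f : A} (hf : ‖f‖ ≤ 1) {r : ℝ} (hr : 0 < r) :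
    ∃ h : A, ∀ y, (1 + r - f.1 y) * h.1 y = r := by
  have hr1 : (1 + r : ℂ) ≠ 0 := by exact_mod_cast (by linarith : (1 + r : ℝ) ≠ 0)
  have ht : ‖((1 + r : ℂ)⁻¹) • f‖ < 1 := by
    rw [norm_smul, norm_inv, show (1 + r : ℂ) = ((1 + r : ℝ) : ℂ) by push_cast; rfl,
      Complex.norm_real, Real.norm_of_nonneg (by linarith), inv_mul_lt_iff₀ (by linarith)]
    linarith
  set u := Units.oneSub _ ht with hu
  refine ⟨((r : ℂ) / (1 + r)) • (u⁻¹ : Aˣ).1, fun y => ?_⟩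
  have h1 : (u.1 * (u⁻¹ : Aˣ).1).1 y = 1 := by rw [Units.mul_inv]; rfl
  have h2 : (1 - (1 + r : ℂ)⁻¹ * f.1 y) * (u⁻¹ : Aˣ).1.1 y = 1 := h1
  change (1 + r - f.1 y) * ((r : ℂ) / (1 + r) * (u⁻¹ : Aˣ).1.1 y) = r
  have h3 : (1 + r - f.1 y) = (1 + r) * (1 - (1 + r : ℂ)⁻¹ * f.1 y) := by
    rw [mul_sub, mul_inv_cancel_left₀ hr1, mul_one]
  rw [h3]
  calc _ = ((1 + r) * ((r : ℂ) / (1 + r))) * ((1 - (1 + r : ℂ)⁻¹ * f.1 y) * (u⁻¹ : Aˣ).1.1 y) := by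
        ring
    _ = r := by rw [h2, mul_one, mul_div_cancel₀ _ hr1]

/-- The distance from `a` to the functions on the sphere that vanish at `x` is at most `|a x|`. A
near-optimal function is a multiple of `a * (1 - h)` with `h = r / (1 + r - f)`, where `f` peaks at
`x`: as `1 - f` has nonnegative real part, both `h` and `1 - h` have modulus at most `1`. -/
lemma IsPeakingPoint.exists_near_zero [CompleteSpace A] {x : X} (hx : IsPeakingPoint A x)
    {a : A} (ha : ‖a‖ = 1) {ε : ℝ} (hε : 0 < ε) (hε1 : ε < 1 - ‖a.1 x‖) :
    ∃ b : A, ‖b‖ = 1 ∧ b.1 x = 0 ∧ ‖a - b‖ ≤ ‖a.1 x‖ + 2 * ε := by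
  have ha1 : ∀ y, ‖a.1 y‖ ≤ 1 := fun y => (norm_apply_le_norm a y).trans ha.le
  have hε2 : ε < 1 := by linarith [norm_nonneg (a.1 x)]
  obtain ⟨f, f1, fx, hg⟩ := exists_peaking_dominating hx.exists_off
    (g := fun y => 1 / 2 * min 1 (‖a.1 y - a.1 x‖ / ε))
    (continuous_const.mul (continuous_const.min
      ((a.1.continuous.sub continuous_const).norm.div_const _)))
    (by rintro y rfl; simp) (δ := 1 / 2) (by norm_num) (by norm_num) (fun y => by
      have := min_le_left (1 : ℝ) (‖a.1 y - a.1 x‖ / ε)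
      linarith)
  have fx := fx x rfl
  have hf1 : ∀ y, ‖f.1 y‖ ≤ 1 := fun y => (norm_apply_le_norm f y).trans f1
  obtain ⟨h, hh⟩ := exists_resolvent f1 (half_pos hε)
  set r : ℝ := ε / 2 with hr
  have hr0 : 0 < r := half_pos hε
  have hnorm : ∀ y, ‖1 + (r : ℂ) - f.1 y‖ * ‖h.1 y‖ = r := fun y => by
    rw [← norm_mul, hh, Complex.norm_real, Real.norm_of_nonneg hr0.le]
  have hlow : ∀ y, 1 + r - ‖f.1 y‖ ≤ ‖1 + (r : ℂ) - f.1 y‖ := fun y => by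
    have h1 := norm_sub_norm_le (1 + (r : ℂ)) (f.1 y)
    rwa [show (1 + r : ℂ) = ((1 + r : ℝ) : ℂ) by push_cast; rfl, Complex.norm_real,
      Real.norm_of_nonneg (by linarith), ← show (1 + r : ℂ) = ((1 + r : ℝ) : ℂ) by
      push_cast; rfl] at h1
  have hh1 : ∀ y, ‖h.1 y‖ ≤ 1 := fun y => by
    have h1 := hlow y
    have h2 := hnorm y
    have h3 := hf1 y
    by_contra hcon
    nlinarith [not_le.1 hcon]
  have hh2 : ∀ y, ‖1 - h.1 y‖ ≤ 1 := fun y => by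
    have h1 : (1 + r - f.1 y) * (1 - h.1 y) = 1 - f.1 y := by rw [mul_sub, hh]; ring
    have h2 : ‖1 + (r : ℂ) - f.1 y‖ * ‖1 - h.1 y‖ = ‖1 - f.1 y‖ := by rw [← norm_mul, h1]
    have h3 : ‖1 - f.1 y‖ ≤ ‖1 + (r : ℂ) - f.1 y‖ := by
      have hre : (f.1 y).re ≤ 1 := (Complex.re_le_norm _).trans (hf1 y)
      rw [← sq_le_sq₀ (norm_nonneg _) (norm_nonneg _), ← Complex.normSq_eq_norm_sq,
        ← Complex.normSq_eq_norm_sq, Complex.normSq_apply, Complex.normSq_apply]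
      simp only [Complex.add_re, Complex.sub_re, Complex.one_re, Complex.ofReal_re,
        Complex.add_im, Complex.sub_im, Complex.one_im, Complex.ofReal_im]
      nlinarith
    have h4 : 0 < ‖1 + (r : ℂ) - f.1 y‖ := by linarith [hlow y, hf1 y]
    by_contra hcon
    nlinarith [not_le.1 hcon]
  have hoff : ∀ y, ε ≤ ‖a.1 y - a.1 x‖ → ‖h.1 y‖ ≤ ε := fun y hy => by
    have h1 : ‖f.1 y‖ ≤ 1 / 2 := by
      have := hg y
      rw [min_eq_left ((one_le_div hε).2 hy)] at this
      linarith
    have h2 := hlow y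
    have h3 := hnorm y
    nlinarith [norm_nonneg (h.1 y)]
  have hhx : h.1 x = 1 := by
    have h1 := hh x
    rw [fx, add_sub_cancel_left] at h1
    exact mul_left_cancel₀ (by exact_mod_cast hr0.ne' : (r : ℂ) ≠ 0) (by rw [h1, mul_one])
  set c : A := a * (1 - h) with hc
  have hcv : ∀ y, c.1 y = a.1 y * (1 - h.1 y) := fun _ => rfl
  have hc1 : ‖c‖ ≤ 1 := norm_le_of_forall_apply zero_le_one fun y => by
    rw [hcv, norm_mul]
    exact mul_le_one₀ (ha1 y) (norm_nonneg _) (hh2 y)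
  obtain ⟨y₀, hy₀⟩ := exists_norm_apply_eq_one ha
  have hc2 : 1 - ε ≤ ‖c‖ := by
    refine le_trans ?_ (norm_apply_le_norm c y₀)
    have h1 := hoff y₀ (by linarith [norm_sub_norm_le (a.1 y₀) (a.1 x)])
    have h2 := norm_sub_norm_le 1 (h.1 y₀)
    rw [hcv, norm_mul, hy₀, one_mul]
    rw [norm_one] at h2
    linarith
  have hc0 : 0 < ‖c‖ := by linarith
  refine ⟨((‖c‖ : ℂ)⁻¹) • c, ?_, ?_, ?_⟩
  · rw [norm_smul, norm_inv, Complex.norm_real, norm_norm, inv_mul_cancel₀ hc0.ne']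
  · change (‖c‖ : ℂ)⁻¹ * c.1 x = 0
    rw [hcv, hhx, sub_self, mul_zero, mul_zero]
  · have h1 : ‖a - c‖ ≤ ‖a.1 x‖ + ε := norm_le_of_forall_apply
        (by linarith [norm_nonneg (a.1 x)]) fun y => by
      have h2 : (a - c).1 y = a.1 y * h.1 y := by
        change a.1 y - c.1 y = _
        rw [hcv]
        ring
      rw [h2, norm_mul]
      rcases le_or_gt ε ‖a.1 y - a.1 x‖ with h3 | h3
      · nlinarith [hoff y h3, ha1 y, norm_nonneg (a.1 y), norm_nonneg (a.1 x),
          norm_nonneg (h.1 y)]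
      · have h4 := norm_sub_norm_le (a.1 y) (a.1 x)
        nlinarith [hh1 y, norm_nonneg (a.1 y)]
    have h2 : ‖c - ((‖c‖ : ℂ)⁻¹) • c‖ ≤ ε := by
      have h3 : c - ((‖c‖ : ℂ)⁻¹) • c = (((1 - ‖c‖⁻¹ : ℝ)) : ℂ) • c := by
        push_cast
        rw [sub_smul, one_smul]
      have h4 : 1 ≤ ‖c‖⁻¹ := (one_le_inv₀ hc0).2 hc1
      rw [h3, norm_smul, Complex.norm_real, Real.norm_of_nonpos (by linarith), neg_sub, sub_mul,
        inv_mul_cancel₀ hc0.ne']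
      linarith
    have h3 := norm_sub_le_norm_sub_add_norm_sub a c (((‖c‖ : ℂ)⁻¹) • c)
    linarith

end PointFaces

/-! ### Isometries of the unit circle -/

lemma exists_linearIsometryEquiv_eq_on_circle {s : ℂ → ℂ} (hs : ∀ γ, ‖γ‖ = 1 → ‖s γ‖ = 1)
    (h1 : s 1 = 1) (hd : ∀ γ γ', ‖γ‖ = 1 → ‖γ'‖ = 1 → ‖s γ - s γ'‖ = ‖γ - γ'‖) :
    ∃ e : ℂ ≃ₗᵢ[ℝ] ℂ, ∀ γ, ‖γ‖ = 1 → s γ = e γ := by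
  have hsq : ∀ z : ℂ, ‖z‖ ^ 2 = z.re ^ 2 + z.im ^ 2 := fun z => by
    rw [← Complex.normSq_eq_norm_sq, Complex.normSq_apply]; ring
  have hunit : ∀ z : ℂ, ‖z‖ = 1 → z.re ^ 2 + z.im ^ 2 = 1 := fun z hz => by
    rw [← hsq, hz, one_pow]
  have hip : ∀ γ γ', ‖γ‖ = 1 → ‖γ'‖ = 1 →
      (s γ).re * (s γ').re + (s γ).im * (s γ').im = γ.re * γ'.re + γ.im * γ'.im := by
    intro γ γ' hγ hγ'
    have h := congrArg (· ^ 2) (hd γ γ' hγ hγ')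
    simp only [hsq, Complex.sub_re, Complex.sub_im] at h
    nlinarith [hunit γ hγ, hunit γ' hγ', hunit _ (hs γ hγ), hunit _ (hs γ' hγ')]
  have hre : ∀ γ, ‖γ‖ = 1 → (s γ).re = γ.re := fun γ hγ => by
    simpa [h1] using hip γ 1 hγ norm_one
  have hI := hre Complex.I Complex.norm_I
  rw [Complex.I_re] at hI
  have hI2 := hunit _ (hs Complex.I Complex.norm_I)
  have him : ∀ γ, ‖γ‖ = 1 → (s γ).im * (s Complex.I).im = γ.im := fun γ hγ => by
    simpa [hI] using hip γ Complex.I hγ Complex.norm_I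
  have hI3 : (s Complex.I).im = 1 ∨ (s Complex.I).im = -1 := by
    rw [hI] at hI2
    exact sq_eq_one_iff.1 (by linarith)
  rcases hI3 with h | h
  · refine ⟨LinearIsometryEquiv.refl ℝ ℂ, fun γ hγ => Complex.ext (hre γ hγ) ?_⟩
    have := him γ hγ
    rw [h, mul_one] at this
    exact this
  · refine ⟨Complex.conjLIE, fun γ hγ => Complex.ext ?_ ?_⟩
    · simpa using hre γ hγ
    · have := him γ hγ
      rw [h] at this
      simp only [Complex.conjLIE_apply, Complex.conj_im]
      linarith

lemma exists_root_near_one {γ : ℂ} (hγ : ‖γ‖ = 1) :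
    ∃ μ : ℂ, ‖μ‖ = 1 ∧ μ ^ 8 = γ ∧ ‖μ - 1‖ < 1 := by
  have hn : ‖((γ.arg / 8 : ℝ) : ℂ) * Complex.I‖ = |γ.arg| / 8 := by
    rw [norm_mul, Complex.norm_I, mul_one, Complex.norm_real, Real.norm_eq_abs, abs_div]
    norm_num
  have hpi := Complex.abs_arg_le_pi γ
  have hpi4 := Real.pi_lt_four
  refine ⟨Complex.exp (((γ.arg / 8 : ℝ) : ℂ) * Complex.I), Complex.norm_exp_ofReal_mul_I _, ?_, ?_⟩
  · rw [← Complex.exp_nat_mul]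
    have := Complex.norm_mul_exp_arg_mul_I γ
    rw [hγ, Complex.ofReal_one, one_mul] at this
    convert! this using 2
    push_cast
    ring
  · refine (Complex.norm_exp_sub_one_le (by rw [hn]; linarith)).trans_lt ?_
    rw [hn]
    linarith

/-- The discs of radius `1 - t` about `l` and of radius `t` about `0` only meet at `t * l`. -/
lemma eq_mul_of_norm_le {β l : ℂ} {t : ℝ} (hl : ‖l‖ = 1) (ht1 : t ≤ 1)
    (h1 : ‖β - l‖ ≤ 1 - t) (h2 : ‖β‖ ≤ t) : β = t * l := by
  have ht0 : 0 ≤ t := (norm_nonneg β).trans h2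
  have hsq : ∀ z : ℂ, ‖z‖ ^ 2 = z.re ^ 2 + z.im ^ 2 := fun z => by
    rw [← Complex.normSq_eq_norm_sq, Complex.normSq_apply]; ring
  have k1 := pow_le_pow_left₀ (norm_nonneg _) h1 2
  have k2 := pow_le_pow_left₀ (norm_nonneg _) h2 2
  have k3 := congrArg (· ^ 2) hl
  simp only [hsq, Complex.sub_re, Complex.sub_im] at k1 k2 k3
  have : ‖β - t * l‖ ^ 2 ≤ 0 := by
    rw [hsq]
    simp only [Complex.sub_re, Complex.sub_im, Complex.re_ofReal_mul, Complex.im_ofReal_mul]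
    nlinarith [mul_le_mul_of_nonneg_left k1 ht0,
      mul_le_mul_of_nonneg_left k2 (by linarith : 0 ≤ 1 - t)]
  have h0 : ‖β - t * l‖ = 0 := by
    have := sq_nonneg ‖β - t * l‖
    exact pow_eq_zero_iff two_ne_zero |>.1 (le_antisymm ‹_› this)
  exact sub_eq_zero.1 (norm_eq_zero.1 h0)

/-! ### Sphere isometries and point evaluations -/

section Evaluation

variable {X : Type*} [TopologicalSpace X] [CompactSpace X] [T2Space X] {A : Subalgebra ℂ C(X, ℂ)}
  {F : Type*} [NormedAddCommGroup F] [NormedSpace ℂ F] {T : A → F}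

/-- The faces `{b | q b = γ}` of the target are pulled back to point slices. Slices at different
points are at Hausdorff distance at least `1`, so all of them live at the same point `x`, and the
dependence on `γ` is an isometry of the circle. -/
lemma IsSphereIsometry.exists_functional_of_unimodular [CompleteSpace A] (hA : A.SeparatesPoints)
    (hT : IsSphereIsometry T) {x : X} (hx : IsSphereFace (pointSlice A x 1)) :
    ∃ (q : F →L[ℂ] ℂ) (e : ℂ ≃ₗᵢ[ℝ] ℂ), (∀ z, ‖q z‖ ≤ ‖z‖) ∧
      ∀ a : A, ‖a‖ = 1 → ‖a.1 x‖ = 1 → q (T a) = e (a.1 x) := by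
  obtain ⟨S, hS, hST, hTS⟩ := hT.exists_inverse
  obtain ⟨q, hq, hqG⟩ := (hT.image_face hx).exists_functional
  let R : ℂ → X → ℂ → Prop := fun γ y σ => ‖σ‖ = 1 ∧ IsSphereFace (pointSlice A y 1) ∧
    ∀ a : A, ‖a‖ = 1 → (q (T a) = γ ↔ a.1 y = σ)
  have hR1 : R 1 x 1 := by
    refine ⟨norm_one, hx, fun a ha => ⟨fun h => ?_, fun h => ?_⟩⟩
    · obtain ⟨c, hc, hca⟩ := (hqG (T a)).2 ⟨hT.norm_map a ha, h⟩
      rw [← hST a ha, ← hca, hST c hc.1]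
      exact hc.2
    · exact ((hqG (T a)).1 ⟨a, ⟨ha, h⟩, rfl⟩).2
  have hR : ∀ γ, ‖γ‖ = 1 → ∃ y σ, R γ y σ := by
    intro γ hγ
    have hγ0 : γ ≠ 0 := norm_ne_zero_iff.1 (by rw [hγ]; exact one_ne_zero)
    have hface := hS.image_face ((isSphereIsometry_smul (E := F) hγ).image_face (hT.image_face hx))
    obtain ⟨y, σ, hσ, heq⟩ := hface.exists_eq_pointSlice
    refine ⟨y, σ, hσ, isSphereFace_pointSlice hσ norm_one (heq ▸ hface), fun a ha => ?_⟩
    have hmem : a.1 y = σ ↔ a ∈ pointSlice A y σ := ⟨fun h => ⟨ha, h⟩, fun h => h.2⟩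
    rw [hmem, ← heq]
    constructor
    · intro h
      refine ⟨T a, ⟨γ⁻¹ • T a, (hqG _).2 ⟨?_, ?_⟩, ?_⟩, hST a ha⟩
      · rw [norm_smul, norm_inv, hγ, inv_one, one_mul, hT.norm_map a ha]
      · rw [map_smul, h, smul_eq_mul, inv_mul_cancel₀ hγ0]
      · exact smul_inv_smul₀ hγ0 _
    · rintro ⟨_, ⟨g, hg, rfl⟩, rfl⟩
      obtain ⟨h1, h2⟩ := (hqG g).1 hg
      rw [hTS _ (by rw [norm_smul, hγ, h1, one_mul]), map_smul, h2, smul_eq_mul, mul_one]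
  have hdist : ∀ {γ γ' y y' σ σ'}, ‖γ‖ = 1 → ‖γ'‖ = 1 → R γ y σ → R γ' y' σ' →
      ∀ a : A, ‖a‖ = 1 → a.1 y = σ → ∃ a' : A, ‖a'‖ = 1 ∧ a'.1 y' = σ' ∧
        ‖a - a'‖ = ‖γ - γ'‖ := by
    intro γ γ' y y' σ σ' hγ hγ' h h' a ha hay
    have hγ0 : γ ≠ 0 := norm_ne_zero_iff.1 (by rw [hγ]; exact one_ne_zero)
    have hb : ‖(γ' / γ) • T a‖ = 1 := by
      rw [norm_smul, norm_div, hγ, hγ', div_one, one_mul, hT.norm_map a ha]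
    have ha' := hS.norm_map _ hb
    refine ⟨S ((γ' / γ) • T a), ha', (h'.2.2 _ ha').1 ?_, ?_⟩
    · rw [hTS _ hb, map_smul, (h.2.2 a ha).2 hay, smul_eq_mul, div_mul_cancel₀ _ hγ0]
    · rw [← hT.norm_sub _ _ ha ha', hTS _ hb]
      have : T a - (γ' / γ) • T a = ((γ - γ') / γ) • T a := by
        rw [sub_div, div_self hγ0, sub_smul, one_smul]
      rw [this, norm_smul, hT.norm_map a ha, mul_one, norm_div, hγ, div_one]
  have hsame : ∀ {γ γ' y y' σ σ'}, ‖γ‖ = 1 → ‖γ'‖ = 1 → R γ y σ → R γ' y' σ' →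
      ‖γ - γ'‖ < 1 → y' = y := by
    intro γ γ' y y' σ σ' hγ hγ' h h' hlt
    by_contra hne
    obtain ⟨c, hc1, hcy, hcy'⟩ := (h.2.1.isPeakingPoint hA).exists_small hne
      (half_pos (sub_pos.2 hlt))
    obtain ⟨a', -, ha', hd⟩ := hdist hγ hγ' h h' (σ • c) (by rw [norm_smul, h.1, hc1, one_mul])
      (by change σ * c.1 y = σ; rw [hcy, mul_one])
    have h1 := norm_apply_le_norm (σ • c - a') y'
    change ‖σ * c.1 y' - a'.1 y'‖ ≤ _ at h1
    rw [hd, ha'] at h1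
    have h2 := norm_sub_norm_le σ' (σ * c.1 y')
    rw [norm_sub_rev, norm_mul, h.1, h'.1, one_mul] at h2
    linarith
  have hRx : ∀ γ, ‖γ‖ = 1 → ∃ σ, R γ x σ := by
    intro γ hγ
    -- walk from `1` to `γ` through the powers of a root of `γ` close to `1`
    obtain ⟨μ, hμ, rfl, hμ1⟩ := exists_root_near_one hγ
    have hpow : ∀ n : ℕ, ‖μ ^ n‖ = 1 := fun n => by rw [norm_pow, hμ, one_pow]
    have : ∀ n : ℕ, ∃ σ, R (μ ^ n) x σ := by
      intro n
      induction n with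
      | zero => exact ⟨1, by rw [pow_zero]; exact hR1⟩
      | succ n ih =>
        obtain ⟨σ, hσ⟩ := ih
        obtain ⟨y, σ', hy⟩ := hR (μ ^ (n + 1)) (hpow _)
        have hyx : y = x := hsame (hpow _) (hpow _) hσ hy (by
          rw [norm_sub_rev, pow_succ, ← mul_sub_one, norm_mul, hpow, one_mul]
          exact hμ1)
        exact ⟨σ', hyx ▸ hy⟩
    exact this 8
  choose! s hs using hRx
  have hconst : ∀ σ : ℂ, ‖σ‖ = 1 → ‖σ • (1 : A)‖ = 1 ∧ (σ • (1 : A)).1 x = σ := by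
    intro σ hσ
    have hv : ∀ y, (σ • (1 : A)).1 y = σ := fun y => mul_one σ
    refine ⟨norm_eq_one_of_apply (x := x) (norm_le_of_forall_apply zero_le_one fun y => ?_) ?_, hv x⟩
    · rw [hv, hσ]
    · rw [hv, hσ]
  obtain ⟨e, he⟩ := exists_linearIsometryEquiv_eq_on_circle (s := s)
    (fun γ hγ => (hs γ hγ).1)
    (by
      have h1 := hconst 1 norm_one
      rw [← ((hs 1 norm_one).2.2 _ h1.1).1 ((hR1.2.2 _ h1.1).2 h1.2), h1.2])
    (fun γ γ' hγ hγ' => by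
      obtain ⟨k1, k2⟩ := hconst _ (hs γ hγ).1
      obtain ⟨k1', k2'⟩ := hconst _ (hs γ' hγ').1
      apply le_antisymm
      · obtain ⟨a', -, ha', hd⟩ := hdist hγ hγ' (hs γ hγ) (hs γ' hγ') _ k1 k2
        rw [← hd]
        have := norm_apply_le_norm (s γ • (1 : A) - a') x
        change ‖(s γ • (1 : A)).1 x - a'.1 x‖ ≤ _ at this
        rwa [k2, ha'] at this
      · have h1 := hq (T (s γ • (1 : A)) - T (s γ' • (1 : A)))
        rw [map_sub, ((hs γ hγ).2.2 _ k1).2 k2, ((hs γ' hγ').2.2 _ k1').2 k2',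
          hT.norm_sub _ _ k1 k1'] at h1
        refine h1.trans (norm_le_of_forall_apply (norm_nonneg _) fun y => ?_)
        change ‖s γ * 1 - s γ' * 1‖ ≤ _
        rw [mul_one, mul_one])
  refine ⟨q, e.symm, hq, fun a ha hax => ?_⟩
  have hγ : ‖e.symm (a.1 x)‖ = 1 := by rw [e.symm.norm_map, hax]
  refine ((hs _ hγ).2.2 a ha).2 ?_
  rw [he _ hγ, e.apply_symm_apply]

/-- The formula of `IsSphereIsometry.exists_functional_of_unimodular` holds for all values at `x`:
the value of `a` at `x` is determined by bounds on the distances from `a` to point slices, first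
for `a x = 0` and then in general. -/
lemma IsSphereIsometry.exists_functional_eq_apply [CompleteSpace A] (hA : A.SeparatesPoints)
    (hT : IsSphereIsometry T) {x : X} (hx : IsSphereFace (pointSlice A x 1)) :
    ∃ (q : F →L[ℂ] ℂ) (e : ℂ ≃ₗᵢ[ℝ] ℂ), (∀ z, ‖q z‖ ≤ ‖z‖) ∧
      ∀ a : A, ‖a‖ = 1 → q (T a) = e (a.1 x) := by
  obtain ⟨q, e, hq, hqe⟩ := hT.exists_functional_of_unimodular hA hx
  have hp := hx.isPeakingPoint hA
  refine ⟨q, e, hq, ?_⟩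
  have hLip : ∀ a b : A, ‖a‖ = 1 → ‖b‖ = 1 → ‖q (T a) - q (T b)‖ ≤ ‖a - b‖ := by
    intro a b ha hb
    rw [← map_sub, ← hT.norm_sub a b ha hb]
    exact hq _
  have hphase : ∀ a : A, ‖a‖ = 1 → ∀ l : ℂ, ‖l‖ = 1 → a.1 x = ‖a.1 x‖ * l →
      ‖q (T a) - e l‖ ≤ 1 - ‖a.1 x‖ := by
    intro a ha l hl hal
    refine le_of_forall_pos_le_add fun ε hε => ?_
    have hmin : 0 < min (ε / 2) (1 / 2) := lt_min (half_pos hε) (by norm_num)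
    obtain ⟨b, hb, hbx, hab⟩ := hp.exists_near_slice ha hl hal hmin
      ((min_le_right _ _).trans_lt (by norm_num))
    have h1 := hLip a b ha hb
    rw [hqe b hb (by rw [hbx, hl]), hbx] at h1
    linarith [min_le_left (ε / 2) (1 / 2)]
  have hzero : ∀ a : A, ‖a‖ = 1 → a.1 x = 0 → q (T a) = 0 := by
    intro a ha hax
    by_contra h0
    -- the phase opposite to that of `q (T a)` gives distance `1 + ‖q (T a)‖`
    have hpos : 0 < ‖q (T a)‖ := norm_pos_iff.2 h0
    have hpos' : (‖q (T a)‖ : ℂ) ≠ 0 := by exact_mod_cast hpos.ne'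
    have hl : ‖e.symm (-(q (T a) / ‖q (T a)‖))‖ = 1 := by
      rw [e.symm.norm_map, norm_neg, norm_div, Complex.norm_real, norm_norm, div_self hpos.ne']
    have h := hphase a ha _ hl (by rw [hax, norm_zero, Complex.ofReal_zero, zero_mul])
    rw [e.apply_symm_apply, hax, norm_zero, sub_neg_eq_add, sub_zero] at h
    have h2 : q (T a) + q (T a) / ‖q (T a)‖ = ((1 + (‖q (T a)‖)⁻¹ : ℝ) : ℂ) * q (T a) := by
      push_cast
      ring
    rw [h2, norm_mul, Complex.norm_real, Real.norm_of_nonneg (by positivity), add_mul,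
      inv_mul_cancel₀ hpos.ne'] at h
    linarith
  intro a ha
  have hα1 : ‖a.1 x‖ ≤ 1 := (norm_apply_le_norm a x).trans ha.le
  rcases hα1.eq_or_lt with h1 | h1
  · exact hqe a ha h1
  have hle : ‖q (T a)‖ ≤ ‖a.1 x‖ := by
    refine le_of_forall_pos_le_add fun ε hε => ?_
    have hmin : 0 < min (ε / 2) ((1 - ‖a.1 x‖) / 2) := lt_min (half_pos hε) (by linarith)
    obtain ⟨b, hb, hbx, hab⟩ := hp.exists_near_zero ha hmin
      ((min_le_right _ _).trans_lt (by linarith))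
    have h2 := hLip a b ha hb
    rw [hzero b hb hbx, sub_zero] at h2
    linarith [min_le_left (ε / 2) ((1 - ‖a.1 x‖) / 2)]
  by_cases h0 : a.1 x = 0
  · rw [hzero a ha h0, h0, map_zero]
  have hpos : 0 < ‖a.1 x‖ := norm_pos_iff.2 h0
  have hpos' : (‖a.1 x‖ : ℂ) ≠ 0 := by exact_mod_cast hpos.ne'
  have hl : ‖a.1 x / ‖a.1 x‖‖ = 1 := by
    rw [norm_div, Complex.norm_real, norm_norm, div_self hpos.ne']
  have hal : a.1 x = ‖a.1 x‖ * (a.1 x / ‖a.1 x‖) := by rw [mul_div_cancel₀ _ hpos']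
  have h := eq_mul_of_norm_le (by rw [e.norm_map, hl]) h1.le (hphase a ha _ hl hal) hle
  rw [h, ← Complex.real_smul, ← map_smul, Complex.real_smul, ← hal]

end Evaluation

/-! ### Homogeneous extension -/

/-- A sphere isometry which, in terms of a norming family of functionals on the target, is given by
real-linear expressions has a real-linear homogeneous extension. -/
lemma IsSphereIsometry.exists_linearIsometryEquiv {E F ι : Type*} [NormedAddCommGroup E]
    [NormedSpace ℂ E] [NormedAddCommGroup F] [NormedSpace ℂ F] {T : E → F}
    (hT : IsSphereIsometry T) (p : ι → E →L[ℂ] ℂ) (q : ι → F →L[ℂ] ℂ) (e : ι → ℂ ≃ₗᵢ[ℝ] ℂ)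
    (hpq : ∀ i a, ‖a‖ = 1 → q i (T a) = e i (p i a))
    (hnorming : ∀ b, ‖b‖ = 1 → ∃ i, q i b ≠ 0) :
    ∃ L : E ≃ₗᵢ[ℝ] F, ∀ a, ‖a‖ = 1 → L a = T a := by
  -- the value at `0` is `0 • T 0 = 0`, whatever `T 0` is
  set L₀ : E → F := fun a => (‖a‖ : ℂ) • T (((‖a‖ : ℂ)⁻¹) • a) with hL₀
  have hunit : ∀ a : E, a ≠ 0 → ‖((‖a‖ : ℂ)⁻¹) • a‖ = 1 := fun a ha => by
    rw [norm_smul, norm_inv, Complex.norm_real, norm_norm, inv_mul_cancel₀ (norm_ne_zero_iff.2 ha)]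
  have hL₀q : ∀ i a, q i (L₀ a) = e i (p i a) := by
    intro i a
    by_cases ha : a = 0
    · simp [hL₀, ha]
    · have hc : (‖a‖ : ℂ) ≠ 0 := by exact_mod_cast norm_ne_zero_iff.2 ha
      rw [hL₀]
      simp only
      rw [map_smul, hpq i _ (hunit a ha), smul_eq_mul, ← Complex.real_smul, ← map_smul,
        Complex.real_smul, map_smul, smul_eq_mul, mul_inv_cancel_left₀ hc]
  have hsep : ∀ b c : F, (∀ i, q i b = q i c) → b = c := by
    intro b c h
    by_contra hne
    have hbc : b - c ≠ 0 := sub_ne_zero.2 hne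
    obtain ⟨i, hi⟩ := hnorming (((‖b - c‖ : ℂ)⁻¹) • (b - c)) (by
      rw [norm_smul, norm_inv, Complex.norm_real, norm_norm,
        inv_mul_cancel₀ (norm_ne_zero_iff.2 hbc)])
    apply hi
    rw [map_smul, map_sub, h i, sub_self, smul_zero]
  let L₁ : E →ₗ[ℝ] F :=
    { toFun := L₀
      map_add' := fun a b => hsep _ _ fun i => by simp only [map_add, hL₀q]
      map_smul' := fun r a => hsep _ _ fun i => by
        rw [RingHom.id_apply, hL₀q, ← Complex.coe_smul r a, ← Complex.coe_smul r (L₀ a),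
          (p i).map_smul, (q i).map_smul, hL₀q, smul_eq_mul, smul_eq_mul, ← Complex.real_smul,
          ← Complex.real_smul, (e i).map_smul] }
  have hnorm : ∀ a, ‖L₁ a‖ = ‖a‖ := by
    intro a
    change ‖L₀ a‖ = _
    by_cases ha : a = 0
    · simp [hL₀, ha]
    · rw [hL₀]
      simp only
      rw [norm_smul, hT.norm_map _ (hunit a ha), mul_one, Complex.norm_real, norm_norm]
  have hext : ∀ a, ‖a‖ = 1 → L₁ a = T a := by
    intro a ha
    change L₀ a = _
    simp [hL₀, ha]
  have hsurj : Function.Surjective L₁ := by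
    intro b
    by_cases hb : b = 0
    · exact ⟨0, by rw [map_zero, hb]⟩
    obtain ⟨a, ha, hab⟩ := hT.surj ((‖b‖⁻¹ : ℝ) • b) (by
      rw [norm_smul, norm_inv, norm_norm, inv_mul_cancel₀ (norm_ne_zero_iff.2 hb)])
    refine ⟨‖b‖ • a, ?_⟩
    rw [map_smul, hext a ha, hab, smul_inv_smul₀ (norm_ne_zero_iff.2 hb)]
  exact ⟨LinearIsometryEquiv.ofSurjective ⟨L₁, hnorm⟩ hsurj, hext⟩

theorem theorem4p5 {X : Type u} [TopologicalSpace X] [CompactSpace X] [T2Space X]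
    (A : Subalgebra ℂ C(X, ℂ)) (hA : IsUniformAlgebra A) :
    HasComplexMazurUlamProperty.{u, v} A := by
  intro F _ _ _ T hT hTs
  have : CompleteSpace A := hA.isClosed.completeSpace_coe
  classical
  let T' : A → F := fun a => if ha : ‖a‖ = 1 then T ⟨a, mem_sphere_zero_iff_norm.2 ha⟩ else 0
  have hT' : ∀ a : Metric.sphere (0 : A) 1, T' a = T a := fun a => by
    have ha : ‖(a : A)‖ = 1 := mem_sphere_zero_iff_norm.1 a.2
    simp only [T', dif_pos ha]
  have hT'' : ∀ a : A, ∀ ha : ‖a‖ = 1, T' a = T ⟨a, mem_sphere_zero_iff_norm.2 ha⟩ :=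
    fun a ha => hT' ⟨a, mem_sphere_zero_iff_norm.2 ha⟩
  have hiso : IsSphereIsometry T' := by
    refine ⟨fun a ha => ?_, fun a b ha hb => ?_, fun b hb => ?_⟩
    · rw [hT'' a ha]
      exact mem_sphere_zero_iff_norm.1 (T _).2
    · rw [hT'' a ha, hT'' b hb, ← dist_eq_norm, ← dist_eq_norm]
      exact hT.dist_eq _ _
    · obtain ⟨a, ha⟩ := hTs ⟨b, mem_sphere_zero_iff_norm.2 hb⟩
      exact ⟨a, mem_sphere_zero_iff_norm.1 a.2, by rw [hT', ha]⟩
  have hfun : ∀ x : {x : X // IsSphereFace (pointSlice A x 1)},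
      ∃ (q : F →L[ℂ] ℂ) (e : ℂ ≃ₗᵢ[ℝ] ℂ), (∀ z, ‖q z‖ ≤ ‖z‖) ∧
        ∀ a : A, ‖a‖ = 1 → q (T' a) = e (a.1 x) := fun x =>
    hiso.exists_functional_eq_apply hA.separatesPoints x.2
  choose q e _ hqe using hfun
  obtain ⟨L, hL⟩ := hiso.exists_linearIsometryEquiv
    (fun x : {x : X // IsSphereFace (pointSlice A x 1)} => evalAt A x.1) q e hqe (by
    intro b hb
    obtain ⟨a, ha, rfl⟩ := hiso.surj b hb
    obtain ⟨C, hC, haC⟩ := exists_sphereFace_mem ha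
    obtain ⟨x, l, hl, rfl⟩ := hC.exists_eq_pointSlice
    refine ⟨⟨x, isSphereFace_pointSlice hl norm_one hC⟩, ?_⟩
    rw [hqe _ a ha, haC.2, ← norm_ne_zero_iff, LinearIsometryEquiv.norm_map, hl]
    exact one_ne_zero)
  exact ⟨L, fun a => by rw [hL a (mem_sphere_zero_iff_norm.1 a.2), hT']⟩
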